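/- A group-word is an element $w=w(x_1,\dots,x_k)$ of the free group on free generators $x_1,x_2,\dots$. For a group $G$, let $G_w$ be the set of all values $w(g_1,\dots,g_k)$ with $g_1,\dots,g_k\in G$, and let $w(G)$ be the subgroup of $G$ generated by $G_w$. Let $c$ and $t$ be positive integers, and let $\mathcal X$ be the class of all groups having a normal subgroup of finite index at most $t$ which is nilpotent of class at most $c$. Then every word $w$ is boundedly concise in $\mathcal X$: for every integer $m\ge 0$ there is a natural number $\nu$, depending only on $c$, $t$, $w$ and $m$, such that every group $G\in\mathcal X$ with $|G_w|\le m$ satisfies $|w(G)|\le\nu$. -/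

import Mathlib

universe u

/-- The set `G_w` of all values `w(g₁, g₂, …)` in `G` of the group-word `w`, an element of the free
group on countably many free generators. Only the finitely many generators that occur in `w`
matter. -/
def wordValues (w : FreeGroup ℕ) (G : Type u) [Group G] : Set G :=
  Set.range fun g : ℕ → G => FreeGroup.lift g w

/-- The verbal subgroup `w(G)`, generated by all `w`-values in `G`. -/
def wordSubgroup (w : FreeGroup ℕ) (G : Type u) [Group G] : Subgroup G :=
  Subgroup.closure (wordValues w G)

/-- The word `w` is boundedly concise in the class `X` of groups: for every `m` there is a natural
number `ν` such that `|w(G)| ≤ ν` for every group `G` in `X` with `|G_w| ≤ m`. Cardinalities are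
taken in `ℕ∞`, so an infinite set satisfies no such bound. -/
def BoundedlyConciseIn (w : FreeGroup ℕ) (X : ∀ (G : Type u) [Group G], Prop) : Prop :=
  ∀ m : ℕ, ∃ ν : ℕ, ∀ (G : Type u) [Group G], X G →
    (wordValues w G).encard ≤ (m : ℕ∞) → (wordSubgroup w G : Set G).encard ≤ (ν : ℕ∞)

/-- The class of groups having a normal subgroup of finite index at most `t` which is nilpotent of
class at most `c`. -/
def NilpotentByBoundedIndex (c t : ℕ) (G : Type u) [Group G] : Prop :=
  ∃ N : Subgroup G, N.Normal ∧ N.FiniteIndex ∧ N.index ≤ t ∧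
    Group.IsNilpotent N ∧ Group.nilpotencyClass N ≤ c

/-!
The proof bounds nothing explicitly. If no bound `ν` existed for some `m`, an ultraproduct `U` of
counterexamples would be a virtually nilpotent group with at most `m` values of `w`
(`isVirtuallyNilpotent_ultraproduct`, `finite_wordValues_ultraproduct`) and with `w(U)` infinite
(`lt_card_wordSubgroup_ultraproduct`). The last point needs a uniform word length: a subgroup with
more than `r` elements already has more than `r` elements of length at most `r` in its generators.

So it suffices to show that a virtually nilpotent group `G` with finitely many values of `w` has
finite `w(G)` (`finite_wordSubgroup`). The arguments producing these values are finite in number,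
so `G` may be taken finitely generated. Then `G` and all its quotients are residually finite
(`Group.IsVirtuallyNilpotent.residuallyFinite`), and a normal subgroup `L` of finite index which is
nilpotent and separates the values of `w` is marginal: changing arguments of `w` modulo `L` does not
change its value. The values of `w` have a centralizer of finite index, so a finitely generated
abelian subgroup `D` has finite index in `w(G)`. If `D` is infinite, take a prime `p` larger than
the index of `L`. By Nakayama some `d ∈ D` is not a `p`-th power in `D`, and residual finiteness of
`G / D ^ p` gives a finite quotient of `G` in which `d` has order `p`. This contradicts
`not_dvd_card_wordSubgroup`: in the finite quotient the Sylow `p`-subgroup of the image of `L` is a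
normal Sylow subgroup, Schur–Zassenhaus gives it a complement `K`, and marginality forces all values
of `w` into the `p'`-group `K`.
-/

open Subgroup
open scoped commutatorElement

/-! ### Subgroups of finitely generated nilpotent groups -/

theorem Subgroup.FG.of_map_of_inf_ker {G H : Type*} [Group G] [Group H] (f : G →* H)
    {K : Subgroup G} (hmap : (K.map f).FG) (hker : (K ⊓ f.ker).FG) : K.FG := by
  classical
  obtain ⟨S, hS⟩ := hker
  obtain ⟨T, hT⟩ := hmap
  have hTK : ∀ y ∈ T, ∃ x ∈ K, f x = y := fun y hy => by
    have : y ∈ K.map f := hT ▸ subset_closure hy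
    simpa using this
  choose! r hrK hr using hTK
  refine ⟨S ∪ T.image r, le_antisymm ?_ fun x hx => ?_⟩
  · rw [closure_le]
    intro x hx
    rcases Finset.mem_union.1 (Finset.mem_coe.1 hx) with h | h
    · exact (hS.le (subset_closure h)).1
    · obtain ⟨y, hy, rfl⟩ := Finset.mem_image.1 h
      exact hrK y hy
  · rw [Finset.coe_union, Subgroup.closure_union, hS]
    have h1 : f x ∈ (closure ((T.image r : Finset G) : Set G)).map f := by
      rw [MonoidHom.map_closure]
      have : f '' ((T.image r : Finset G) : Set G) = T := by
        rw [Finset.coe_image, Set.image_image]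
        simpa using Set.image_congr (f := fun y => f (r y)) (g := id) (s := (T : Set H)) hr
      rw [this, hT]
      exact mem_map_of_mem f hx
    obtain ⟨y, hy, hxy⟩ := h1
    have hyK : y ∈ K := by
      refine (closure_le K).2 ?_ hy
      intro z hz
      obtain ⟨v, hv, rfl⟩ := Finset.mem_image.1 (Finset.mem_coe.1 hz)
      exact hrK v hv
    have h2 : x * y⁻¹ ∈ K ⊓ f.ker :=
      ⟨K.mul_mem hx (K.inv_mem hyK), by simp [hxy]⟩
    rw [← inv_mul_cancel_right x y]
    exact mul_mem (le_sup_left (a := K ⊓ f.ker) h2)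
      (le_sup_right (a := K ⊓ f.ker) hy)

theorem Subgroup.fg_of_commGroup {A : Type*} [CommGroup A] [Group.FG A] (K : Subgroup A) :
    K.FG := by
  have : Module.Finite ℤ (Additive A) := Module.Finite.iff_addGroup_fg.2 inferInstance
  have h : (AddSubgroup.toIntSubmodule (Subgroup.toAddSubgroup K)).FG := IsNoetherian.noetherian _
  rw [Submodule.fg_iff_addSubgroup_fg] at h
  exact (Subgroup.fg_iff_add_fg K).2 h

theorem Subgroup.FG.of_le_center {G : Type*} [Group G] {K L : Subgroup G} (hL : L.FG)
    (hLc : L ≤ center G) (hKL : K ≤ L) : K.FG := by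
  have hcomm : ∀ a b : L, a * b = b * a := fun a b =>
    Subtype.ext ((mem_center_iff.1 (hLc a.2) b).symm)
  let _ : CommGroup L := { (inferInstance : Group L) with mul_comm := hcomm }
  have : Group.FG L := (Group.fg_iff_subgroup_fg L).2 hL
  have h := Subgroup.fg_of_commGroup (K.subgroupOf L)
  rw [← Group.fg_iff_subgroup_fg] at h ⊢
  exact Group.fg_of_surjective (f := (Subgroup.subgroupOfEquivOfLe hKL).toMonoidHom)
    (Subgroup.subgroupOfEquivOfLe hKL).surjective

/-- The commutator map on `K × G` is bilinear modulo the central subgroup `L`, so finitely many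
generators of `K` modulo `L` and of `G` give finitely many generators of `⁅K, G⁆`. -/
theorem Subgroup.fg_commutator_top {G : Type*} [Group G] [Group.FG G] {K L : Subgroup G}
    (hL : L ≤ center G) (hKL : ⁅K, (⊤ : Subgroup G)⁆ ≤ L) [L.Normal]
    (hK : (K.map (QuotientGroup.mk' L)).FG) : (⁅K, (⊤ : Subgroup G)⁆ : Subgroup G).FG := by
  classical
  obtain ⟨T, hT⟩ := hK
  obtain ⟨S, hS⟩ := Group.fg_def.1 ‹Group.FG G›
  have hTK : ∀ y ∈ T, ∃ x ∈ K, QuotientGroup.mk' L x = y := fun y hy => by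
    have : y ∈ K.map (QuotientGroup.mk' L) := hT ▸ subset_closure hy
    simpa using this
  choose! r hrK hr using hTK
  set X : Finset G := (T ×ˢ S).image fun p => ⁅r p.1, p.2⁆ with hX
  set B := closure (X : Set G) with hB
  have hBle : B ≤ ⁅K, (⊤ : Subgroup G)⁆ := by
    rw [closure_le]
    intro x hx
    obtain ⟨p, hp, rfl⟩ := Finset.mem_image.1 (Finset.mem_coe.1 hx)
    exact commutator_mem_commutator (hrK _ (Finset.mem_product.1 hp).1) (mem_top _)
  have hBc : B ≤ center G := hBle.trans (hKL.trans hL)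
  have hBn : B.Normal := ⟨fun n hn g => by
    rw [mem_center_iff.1 (hBc hn) g, mul_inv_cancel_right]
    exact hn⟩
  refine ⟨X, le_antisymm hBle ?_⟩
  -- Modulo `B` the generators of `K` commute with the generators of `G`, so `K` becomes central.
  let q := QuotientGroup.mk' B
  have hq : Function.Surjective q := QuotientGroup.mk'_surjective B
  have hTc : ∀ y ∈ T, q (r y) ∈ center (G ⧸ B) := fun y hy => by
    have h1 : (⊤ : Subgroup G) ≤ (centralizer {q (r y)}).comap q := by
      rw [← hS, closure_le]
      intro s hs
      have : q ⁅r y, s⁆ = 1 := (QuotientGroup.eq_one_iff _).2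
        (subset_closure (Finset.mem_image.2 ⟨(y, s), Finset.mem_product.2 ⟨hy, hs⟩, rfl⟩))
      rw [map_commutatorElement, commutatorElement_eq_one_iff_mul_comm] at this
      exact mem_centralizer_singleton_iff.2 this.symm
    rw [mem_center_iff]
    intro z
    obtain ⟨z, rfl⟩ := hq z
    exact mem_centralizer_singleton_iff.1 (h1 (mem_top z))
  have hLq : ∀ x ∈ center G, q x ∈ center (G ⧸ B) := fun x hx => by
    rw [mem_center_iff]
    intro z
    obtain ⟨z, rfl⟩ := hq z
    rw [← map_mul, ← map_mul, mem_center_iff.1 hx z]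
  have hKq : K ≤ (center (G ⧸ B)).comap q := fun x hx => by
    have h1 : QuotientGroup.mk' L x ∈
        ((closure ((T.image r : Finset G) : Set G))).map (QuotientGroup.mk' L) := by
      rw [MonoidHom.map_closure]
      have : QuotientGroup.mk' L '' ((T.image r : Finset G) : Set G) = T := by
        rw [Finset.coe_image, Set.image_image]
        simpa using Set.image_congr (f := fun y => QuotientGroup.mk' L (r y)) (g := id)
          (s := (T : Set _)) hr
      rw [this, hT]
      exact mem_map_of_mem _ hx
    obtain ⟨y, hy, hxy⟩ := h1
    have hyq : y ∈ (center (G ⧸ B)).comap q := by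
      refine (closure_le _).2 ?_ hy
      intro z hz
      obtain ⟨v, hv, rfl⟩ := Finset.mem_image.1 (Finset.mem_coe.1 hz)
      exact hTc v hv
    have h2 : y⁻¹ * x ∈ L := QuotientGroup.eq.1 hxy
    rw [← mul_inv_cancel_left y x]
    exact mul_mem hyq (hLq _ (hL h2))
  rw [commutator_le]
  intro x hx g _
  refine (QuotientGroup.eq_one_iff _).1 ?_
  change q ⁅x, g⁆ = 1
  rw [map_commutatorElement, commutatorElement_eq_one_iff_mul_comm]
  exact (mem_center_iff.1 (hKq hx) (q g)).symm

/-- By induction, the quotient by the last nontrivial term `L` of the lower central series has only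
finitely generated subgroups; `L` is central, and finitely generated by
`Subgroup.fg_commutator_top`. -/
theorem Subgroup.fg_of_lowerCentralSeries_eq_bot (n : ℕ) :
    ∀ (G : Type u) [Group G] [Group.FG G], (⊤ : Subgroup G).lowerCentralSeries n = ⊥ →
      ∀ K : Subgroup G, K.FG := by
  induction n with
  | zero =>
    intro G _ _ h K
    have : K = ⊥ := by rw [eq_bot_iff, ← h]; exact le_top
    exact this ▸ Subgroup.FG.bot
  | succ n ih =>
    intro G _ _ h K
    set L := (⊤ : Subgroup G).lowerCentralSeries n with hL
    have hLc : L ≤ center G := fun x hx => by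
      rw [mem_center_iff]
      intro g
      have : ⁅x, g⁆ ∈ (⊤ : Subgroup G).lowerCentralSeries (n + 1) :=
        commutator_mem_commutator hx (mem_top g)
      rw [h, mem_bot, commutatorElement_eq_one_iff_mul_comm] at this
      exact this.symm
    have hquot : ∀ K : Subgroup (G ⧸ L), K.FG := by
      refine ih (G ⧸ L) ?_
      have := map_lowerCentralSeries (⊤ : Subgroup G) (QuotientGroup.mk' L) n
      rw [← MonoidHom.range_eq_map, MonoidHom.range_eq_top.2 (QuotientGroup.mk'_surjective L)]
        at this
      rw [← this, ← hL, map_eq_bot_iff, QuotientGroup.ker_mk']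
    have hLfg : L.FG := by
      cases n with
      | zero => exact Group.fg_def.1 ‹_›
      | succ k => exact fg_commutator_top hLc le_rfl (hquot _)
    refine Subgroup.FG.of_map_of_inf_ker (QuotientGroup.mk' L) (hquot _) ?_
    exact hLfg.of_le_center hLc (by rw [QuotientGroup.ker_mk']; exact inf_le_right)

/-- Finitely generated nilpotent groups satisfy the maximal condition on subgroups. -/
theorem Subgroup.fg_of_isNilpotent {G : Type u} [Group G] [Group.FG G] [Group.IsNilpotent G]
    (K : Subgroup G) : K.FG := by
  obtain ⟨n, hn⟩ := nilpotent_iff_lowerCentralSeries.1 (inferInstance : Group.IsNilpotent G)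
  exact fg_of_lowerCentralSeries_eq_bot n G hn K

/-! ### Residual finiteness of finitely generated virtually nilpotent groups -/

/-- An element `x` of the second centre is determined modulo the centre by its commutators with
finitely many generators; these are central, so a finite centre forces a finite second centre. -/
theorem finite_center_quotient_center {G : Type u} [Group G] [Group.FG G] [Finite (center G)] :
    Finite (center (G ⧸ center G)) := by
  classical
  obtain ⟨S, hS⟩ := Group.fg_def.1 ‹Group.FG G›
  have hc : ∀ (x : center (G ⧸ center G)) (s : G), ⁅x.1.out, s⁆ ∈ center G := fun x s => by
    refine (QuotientGroup.eq_one_iff _).1 ?_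
    change QuotientGroup.mk' (center G) ⁅x.1.out, s⁆ = 1
    rw [map_commutatorElement, commutatorElement_eq_one_iff_mul_comm]
    simpa using! (mem_center_iff.1 x.2 (s : G ⧸ center G)).symm
  let F : center (G ⧸ center G) → (S → center G) := fun x s => ⟨⁅x.1.out, s⁆, hc x s⟩
  refine Finite.of_injective F fun x y hxy => ?_
  have hs : ∀ s ∈ S, s * (y.1.out⁻¹ * x.1.out) = (y.1.out⁻¹ * x.1.out) * s := fun s hs => by
    have h1 : ⁅x.1.out, s⁆ = ⁅y.1.out, s⁆ := congrArg Subtype.val (congrFun hxy ⟨s, hs⟩)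
    rw [commutatorElement_def, commutatorElement_def, mul_left_inj] at h1
    calc s * (y.1.out⁻¹ * x.1.out)
        = y.1.out⁻¹ * (y.1.out * s * y.1.out⁻¹) * x.1.out := by group
      _ = y.1.out⁻¹ * (x.1.out * s * x.1.out⁻¹) * x.1.out := by rw [h1]
      _ = _ := by group
  have hcent : y.1.out⁻¹ * x.1.out ∈ center G := by
    have h1 : (⊤ : Subgroup G) ≤ centralizer {y.1.out⁻¹ * x.1.out} := by
      rw [← hS, closure_le]
      exact fun s hs' => mem_centralizer_singleton_iff.2 (hs s hs')
    exact mem_center_iff.2 fun g => mem_centralizer_singleton_iff.1 (h1 (mem_top g))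
  have := QuotientGroup.eq.2 hcent
  rw [QuotientGroup.out_eq', QuotientGroup.out_eq'] at this
  exact Subtype.ext this.symm

theorem Group.IsNilpotent.finite_of_finite_center {G : Type u} [Group G] [Group.IsNilpotent G]
    (hfg : Group.FG G) (hZ : Finite (center G)) : Finite G := by
  refine Group.nilpotent_center_quotient_ind
    (P := fun G _ _ => Group.FG G → Finite (center G) → Finite G) G ?_ ?_ hfg hZ
  · intros
    infer_instance
  · intro G _ _ ih hfg hZ
    have := ih inferInstance finite_center_quotient_center
    exact Finite.of_subgroup_quotient (center G)

/-- Let every nontrivial normal subgroup contain `g ≠ 1`. The powers of a central element of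
infinite order would give nontrivial normal subgroups with trivial intersection, so the centre is
a torsion group. -/
theorem Group.IsNilpotent.finite_of_forall_mem_normal {G : Type u} [Group G] [Group.IsNilpotent G]
    [Group.FG G] {g : G} (hg : g ≠ 1)
    (h : ∀ N : Subgroup G, N.Normal → N ≠ ⊥ → g ∈ N) : Finite G := by
  refine Group.IsNilpotent.finite_of_finite_center inferInstance ?_
  have hnormal : ∀ z ∈ center G, (zpowers z).Normal := fun z hz =>
    ⟨fun n hn x => by
      have : n ∈ center G := (zpowers_le.2 hz) hn
      rw [mem_center_iff.1 this x, mul_inv_cancel_right]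
      exact hn⟩
  have : Group.FG (center G) := (Group.fg_iff_subgroup_fg _).2 (fg_of_isNilpotent _)
  let _ : CommGroup (center G) := { (inferInstance : Group (center G)) with
    mul_comm := fun a b => Subtype.ext (mem_center_iff.1 b.2 a) }
  refine CommGroup.finite_of_fg_isMulTorsion (center G) ?_
  rintro ⟨z, hz⟩
  refine (center G).subtype_injective.isOfFinOrder_iff.1 ?_
  change IsOfFinOrder z
  by_contra hinf
  have hzpow : ∀ n : ℤ, z ^ n = 1 → n = 0 := fun n hn => by
    by_contra hn0
    exact hinf (isOfFinOrder_iff_zpow_eq_one.2 ⟨n, hn0, hn⟩)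
  have hmem : ∀ n : ℤ, n ≠ 0 → g ∈ zpowers (z ^ n) := fun n hn =>
    h _ (hnormal _ (zpow_mem hz n)) (by rw [Ne, zpowers_eq_bot]; exact fun h => hn (hzpow n h))
  obtain ⟨a, ha⟩ := mem_zpowers_iff.1 (hmem 1 one_ne_zero)
  rw [zpow_one] at ha
  have ha0 : a ≠ 0 := by
    rintro rfl
    exact hg (by rw [← ha, zpow_zero])
  obtain ⟨b, hb⟩ := mem_zpowers_iff.1 (hmem (2 * a) (by omega))
  have h0 : a * (1 - 2 * b) = 0 := hzpow _ (by
    rw [show a * (1 - 2 * b) = a - 2 * a * b by ring, zpow_sub, zpow_mul, hb, ha, mul_inv_cancel])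
  rcases mul_eq_zero.1 h0 with h0 | h0
  · exact ha0 h0
  · omega

/-- A normal subgroup `K` maximal among those avoiding `g` has finite index, as every nontrivial
normal subgroup of `G ⧸ K` contains the image of `g`. -/
theorem Group.IsNilpotent.residuallyFinite {G : Type u} [Group G] [Group.IsNilpotent G]
    [Group.FG G] : Group.ResiduallyFinite G := by
  rw [Group.residuallyFinite_iff_exists_finiteIndex]
  intro g hg
  obtain ⟨K, -, hK⟩ := zorn_le_nonempty₀ {K : Subgroup G | K.Normal ∧ g ∉ K}
    (fun c hc hchain y hy => by
      have hdir := hchain.directedOn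
      have hne : c.Nonempty := ⟨y, hy⟩
      refine ⟨sSup c, ⟨⟨fun n hn x => ?_⟩, fun h => ?_⟩, fun z hz => le_sSup hz⟩
      · obtain ⟨N, hN, hnN⟩ := (mem_sSup_of_directedOn hne hdir).1 hn
        exact (mem_sSup_of_directedOn hne hdir).2 ⟨N, hN, (hc hN).1.conj_mem n hnN x⟩
      · obtain ⟨N, hN, hgN⟩ := (mem_sSup_of_directedOn hne hdir).1 h
        exact (hc hN).2 hgN) ⊥ ⟨inferInstance, by simpa using hg⟩
  have hKn : K.Normal := hK.prop.1
  refine ⟨K, ?_, hK.prop.2⟩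
  have hsurj := QuotientGroup.mk'_surjective K
  have hfin : Finite (G ⧸ K) := by
    refine Group.IsNilpotent.finite_of_forall_mem_normal (g := QuotientGroup.mk' K g)
      (fun h => hK.prop.2 ((QuotientGroup.eq_one_iff g).1 h)) fun N hN hbot => ?_
    by_contra hgN
    have hle : K ≤ N.comap (QuotientGroup.mk' K) := by
      conv_lhs => rw [← QuotientGroup.ker_mk' K]
      exact MonoidHom.ker_le_comap _ N
    have heq : N.comap (QuotientGroup.mk' K) ≤ K := hK.le_of_ge ⟨hN.comap _, hgN⟩ hle
    refine hbot (eq_bot_iff.2 fun x hx => ?_)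
    obtain ⟨x, rfl⟩ := hsurj x
    exact (QuotientGroup.eq_one_iff x).2 (heq hx)
  exact finiteIndex_of_finite_quotient

theorem Group.IsVirtuallyNilpotent.residuallyFinite {G : Type u} [Group G] [Group.FG G]
    (hG : Group.IsVirtuallyNilpotent G) : Group.ResiduallyFinite G := by
  obtain ⟨N, hN, hfin⟩ := hG
  have : Group.ResiduallyFinite N := Group.IsNilpotent.residuallyFinite
  rw [Group.residuallyFinite_iff_exists_finiteIndex]
  intro g hg
  by_cases hgN : g ∈ N
  · obtain ⟨K, hK, hgK⟩ := Group.residuallyFinite_iff_exists_finiteIndex.1 this ⟨g, hgN⟩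
      (fun h => hg (congrArg (fun z : N => (z : G)) h))
    refine ⟨K.map N.subtype, ⟨?_⟩, ?_⟩
    · rw [index_map_subtype]
      exact mul_ne_zero hK.index_ne_zero hfin.index_ne_zero
    · rintro ⟨x, hx, hxg⟩
      exact hgK (by rwa [show (⟨g, hgN⟩ : N) = x from Subtype.ext hxg.symm])
  · exact ⟨N, hfin, hgN⟩

theorem Group.IsVirtuallyNilpotent.of_surjective {G H : Type*} [Group G] [Group H]
    (hG : Group.IsVirtuallyNilpotent G) {f : G →* H} (hf : Function.Surjective f) :
    Group.IsVirtuallyNilpotent H := by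
  obtain ⟨N, hN, hfin⟩ := hG
  refine ⟨N.map f, Group.nilpotent_of_surjective (f.subgroupMap N) (f.subgroupMap_surjective N),
    ⟨?_⟩⟩
  exact fun h => hfin.index_ne_zero (Nat.eq_zero_of_zero_dvd (h ▸ N.index_map_dvd hf))

theorem Group.IsVirtuallyNilpotent.subgroup {G : Type*} [Group G]
    (hG : Group.IsVirtuallyNilpotent G) (H : Subgroup G) : Group.IsVirtuallyNilpotent H := by
  obtain ⟨N, hN, hfin⟩ := hG
  refine ⟨N.subgroupOf H, ?_, inferInstance⟩
  let f : N.subgroupOf H →* N := H.subtype.subgroupComap N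
  have hf : Function.Injective f := fun x y h =>
    Subtype.ext (Subtype.ext (congrArg (fun z : N => (z : G)) h))
  exact Subgroup.isNilpotent_of_ker_le_center f
    (((MonoidHom.ker_eq_bot_iff f).2 hf).le.trans bot_le)

/-! ### Word values, homomorphisms and marginal subgroups -/

theorem map_lift_word {G H : Type*} [Group G] [Group H] (f : G →* H) (w : FreeGroup ℕ)
    (g : ℕ → G) : f (FreeGroup.lift g w) = FreeGroup.lift (fun i => f (g i)) w :=
  DFunLike.congr_fun
    (FreeGroup.ext_hom (f.comp (FreeGroup.lift g)) (FreeGroup.lift fun i => f (g i))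
      fun i => by simp) w

theorem lift_word_mem {G : Type*} [Group G] {K : Subgroup G} {g : ℕ → G} (hg : ∀ i, g i ∈ K)
    (w : FreeGroup ℕ) : FreeGroup.lift g w ∈ K := by
  have h := map_lift_word K.subtype w fun i => (⟨g i, hg i⟩ : K)
  exact h ▸ Subtype.prop _

theorem image_wordValues_subset {w : FreeGroup ℕ} {G H : Type u} [Group G] [Group H] (f : G →* H) :
    f '' wordValues w G ⊆ wordValues w H := by
  rintro _ ⟨_, ⟨g, rfl⟩, rfl⟩
  exact ⟨fun i => f (g i), (map_lift_word f w g).symm⟩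

theorem map_wordSubgroup_le {w : FreeGroup ℕ} {G H : Type u} [Group G] [Group H] (f : G →* H) :
    (wordSubgroup w G).map f ≤ wordSubgroup w H := by
  rw [wordSubgroup, MonoidHom.map_closure]
  exact closure_mono (image_wordValues_subset f)

instance wordSubgroup_normal (w : FreeGroup ℕ) (G : Type u) [Group G] :
    (wordSubgroup w G).Normal :=
  ⟨fun _ hn g => map_wordSubgroup_le (MulAut.conj g).toMonoidHom (mem_map_of_mem _ hn)⟩

/-- A subgroup `M` is marginal for the word `w` if multiplying the arguments of `w` by elements
of `M` does not change the value of `w`. -/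
def IsMarginal (w : FreeGroup ℕ) {G : Type*} [Group G] (M : Subgroup G) : Prop :=
  ∀ g x : ℕ → G, (∀ i, x i ∈ M) → FreeGroup.lift (fun i => g i * x i) w = FreeGroup.lift g w

theorem IsMarginal.mono {w : FreeGroup ℕ} {G : Type*} [Group G] {M N : Subgroup G}
    (hM : IsMarginal w M) (h : N ≤ M) : IsMarginal w N :=
  fun g x hx => hM g x fun i => h (hx i)

theorem IsMarginal.map {w : FreeGroup ℕ} {G H : Type*} [Group G] [Group H] {M : Subgroup G}
    (hM : IsMarginal w M) {f : G →* H} (hf : Function.Surjective f) : IsMarginal w (M.map f) := by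
  intro g x hx
  choose g' hg' using fun i => hf (g i)
  choose x' hx' hxx' using hx
  obtain rfl : (fun i => f (g' i)) = g := funext hg'
  obtain rfl : (fun i => f (x' i)) = x := funext hxx'
  simp only [← map_mul, ← map_lift_word, hM g' x' hx']

/-- A normal subgroup of finite index that separates the finitely many values of `w` is marginal,
because `w` takes congruent values at congruent arguments. -/
theorem exists_isMarginal_of_residuallyFinite {w : FreeGroup ℕ} {G : Type u} [Group G]
    [Group.ResiduallyFinite G] (hw : (wordValues w G).Finite) :
    ∃ M : Subgroup G, M.Normal ∧ M.FiniteIndex ∧ IsMarginal w M := by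
  have hsep : ∀ p : wordValues w G × wordValues w G, ∃ K : Subgroup G, K.Normal ∧ K.FiniteIndex ∧
      (p.1.1⁻¹ * p.2.1 ∈ K → p.1 = p.2) := fun p => by
    by_cases h : p.1 = p.2
    · exact ⟨⊤, inferInstance, inferInstance, fun _ => h⟩
    · obtain ⟨K, hK⟩ := Group.exists_finiteIndexNormalSubgroup_notMem (p.1.1⁻¹ * p.2.1)
        fun h' => h (Subtype.ext (inv_mul_eq_one.1 h'))
      exact ⟨K.toSubgroup, inferInstance, inferInstance, fun h' => absurd h' hK⟩
  choose K hKn hKf hK using hsep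
  have : Finite (wordValues w G) := hw
  have hn : (⨅ p, K p).Normal := normal_iInf_normal hKn
  refine ⟨⨅ p, K p, hn, finiteIndex_iInf hKf, fun g x hx => ?_⟩
  let q := QuotientGroup.mk' (⨅ p, K p)
  have h : q (FreeGroup.lift g w) = q (FreeGroup.lift (fun i => g i * x i) w) := by
    rw [map_lift_word, map_lift_word]
    congr 2
    funext i
    exact QuotientGroup.eq.2 (by simpa using! hx i)
  have h1 := QuotientGroup.eq.1 h
  exact (congrArg Subtype.val (hK (⟨_, g, rfl⟩, ⟨_, _, rfl⟩) (mem_iInf.1 h1 _))).symm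

/-! ### Finite groups with a nilpotent marginal subgroup -/

/-- The Sylow `p`-subgroup `P` of `M` is a normal Sylow subgroup of `G`, with a complement `K` by
Schur–Zassenhaus. As `P` is marginal, `w` takes all its values on `K`, so `w(G) ≤ K` is a
`p'`-group. -/
theorem not_dvd_card_wordSubgroup {w : FreeGroup ℕ} {G : Type u} [Group G] [Finite G] {p : ℕ}
    (hp : p.Prime) {M : Subgroup G} [M.Normal] [Group.IsNilpotent M] (hM : IsMarginal w M)
    (hpM : ¬ p ∣ M.index) : ¬ p ∣ Nat.card (wordSubgroup w G) := by
  have : Fact p.Prime := ⟨hp⟩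
  let P : Sylow p M := default
  have hPc : P.1.Characteristic := P.characteristic_of_normal inferInstance
  have hPn : (P.1.map M.subtype).Normal := ConjAct.normal_of_characteristic_of_normal
  have hindex : ¬ p ∣ (P.1.map M.subtype).index := by
    rw [index_map_subtype, hp.dvd_mul, not_or]
    exact ⟨P.not_dvd_index, hpM⟩
  have hcop : (Nat.card (P.1.map M.subtype)).Coprime (P.1.map M.subtype).index := by
    rw [Nat.card_congr (P.1.equivMapOfInjective _ M.subtype_injective).toEquiv.symm]
    obtain ⟨n, hn⟩ := P.2.exists_card_eq
    rw [hn]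
    exact Nat.Coprime.pow_left n ((Nat.Prime.coprime_iff_not_dvd hp).2 hindex)
  obtain ⟨K, hK⟩ := exists_left_complement'_of_coprime hcop
  have hle : wordSubgroup w G ≤ K := by
    rw [wordSubgroup, closure_le]
    rintro _ ⟨g, rfl⟩
    have hdec : ∀ i, ∃ k ∈ K, ∃ x ∈ M, k * x = g i := fun i => by
      obtain ⟨⟨k, x⟩, hkx⟩ := hK.2 (g i)
      exact ⟨k, k.2, x, map_subtype_le _ x.2, hkx⟩
    choose k hk x hx hkx using hdec
    obtain rfl : (fun i => k i * x i) = g := funext hkx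
    simp only [hM k x hx]
    exact lift_word_mem hk w
  intro h
  exact hindex (by rw [hK.index_eq_card]; exact h.trans (card_dvd_of_le hle))

/-! ### Finitely generated virtually nilpotent groups with finitely many word values -/

theorem finiteIndex_centralizer_of_finite {G : Type*} [Group G] {V : Set G} (hV : V.Finite)
    (hconj : ∀ g : G, ∀ v ∈ V, g * v * g⁻¹ ∈ V) : (centralizer V).FiniteIndex := by
  have : Finite V := hV
  let F : G ⧸ centralizer V → V → V := fun x v => ⟨x.out * v * x.out⁻¹, hconj _ v v.2⟩
  have : Finite (G ⧸ centralizer V) := by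
    refine Finite.of_injective F fun x y hxy => ?_
    rw [← QuotientGroup.out_eq' x, ← QuotientGroup.out_eq' y, QuotientGroup.eq,
      mem_centralizer_iff]
    intro v hv
    have h1 : x.out * v * x.out⁻¹ = y.out * v * y.out⁻¹ :=
      congrArg Subtype.val (congrFun hxy ⟨v, hv⟩)
    calc v * (x.out⁻¹ * y.out) = x.out⁻¹ * (x.out * v * x.out⁻¹) * y.out := by group
      _ = x.out⁻¹ * (y.out * v * y.out⁻¹) * y.out := by rw [h1]
      _ = x.out⁻¹ * y.out * v := by group
  exact finiteIndex_of_finite_quotient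

/-- By Nakayama's lemma, a finitely generated abelian group with `A = A ^ p` is annihilated by some
integer congruent to `1` modulo `p`. -/
theorem finite_of_forall_exists_pow_eq {A : Type*} [CommGroup A] [Group.FG A] {p : ℕ}
    (hp : 1 < p) (h : ∀ a : A, ∃ b : A, b ^ p = a) : Finite A := by
  have : Module.Finite ℤ (Additive A) := Module.Finite.iff_addGroup_fg.2 inferInstance
  obtain ⟨r, hr, hr0⟩ := Submodule.exists_sub_one_mem_and_smul_eq_zero_of_fg_of_le_smul
    (Ideal.span {(p : ℤ)}) (⊤ : Submodule ℤ (Additive A)) Module.Finite.fg_top fun a _ => by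
      obtain ⟨b, hb⟩ := h a.toMul
      have : (p : ℤ) • Additive.ofMul b = a := by
        rw [natCast_zsmul, ← ofMul_pow, hb, ofMul_toMul]
      rw [← this]
      exact Submodule.smul_mem_smul (Ideal.mem_span_singleton_self _) trivial
  have hr' : r ≠ 0 := by
    rintro rfl
    obtain ⟨c, hc⟩ := Ideal.mem_span_singleton.1 hr
    have : (p : ℤ) ∣ 1 := ⟨-c, by linarith⟩
    have := Int.le_of_dvd one_pos this
    omega
  refine CommGroup.finite_of_fg_isMulTorsion A fun a => ?_
  exact isOfFinOrder_iff_zpow_eq_one.2 ⟨r, hr', hr0 (Additive.ofMul a) trivial⟩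

/-- The finitely generated case of `finite_wordSubgroup`: if the abelian subgroup `D` of finite
index in `w(G)` were infinite, a prime `p` not dividing the index of a nilpotent marginal subgroup
would divide the order of the verbal subgroup of some finite quotient of `G`. -/
theorem finite_wordSubgroup_of_fg {w : FreeGroup ℕ} {G : Type u} [Group G] [Group.FG G]
    (hG : Group.IsVirtuallyNilpotent G) (hw : (wordValues w G).Finite) :
    Finite (wordSubgroup w G) := by
  have hRF := hG.residuallyFinite
  obtain ⟨M, hMn, hMf, hMw⟩ := exists_isMarginal_of_residuallyFinite hw
  obtain ⟨N, hNnil, hNf⟩ := id hG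
  -- a normal subgroup of finite index that is both nilpotent and marginal
  set L := M ⊓ N.normalCore with hL
  have hLnil : Group.IsNilpotent L := by
    have := Subgroup.isNilpotent (L.subgroupOf N)
    exact Group.nilpotent_of_mulEquiv (subgroupOfEquivOfLe (inf_le_right.trans N.normalCore_le))
  have hLf : L.FiniteIndex := inferInstance
  set W := wordSubgroup w G with hW
  have hWfg : Group.FG W := by
    have : Finite (wordValues w G) := hw
    exact Group.closure_finite_fg _
  set C := centralizer (W : Set G) with hC
  have hCf : C.FiniteIndex := by
    rw [hC, hW, wordSubgroup, centralizer_closure]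
    exact finiteIndex_centralizer_of_finite hw fun g v hv =>
      image_wordValues_subset (MulAut.conj g).toMonoidHom ⟨v, hv, rfl⟩
  set D := C.subgroupOf W with hD
  have hcomm : ∀ a b : D, a * b = b * a := fun a b =>
    Subtype.ext (Subtype.ext (mem_centralizer_iff.1 b.2 a.1 a.1.2))
  let _ : CommGroup D := { (inferInstance : Group D) with mul_comm := hcomm }
  suffices Finite D by
    have : D.FiniteIndex := inferInstance
    exact Finite.of_subgroup_quotient D
  obtain ⟨p, hple, hp⟩ := Nat.exists_infinite_primes (L.index + 1)
  have : Group.FG D := inferInstance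
  refine finite_of_forall_exists_pow_eq hp.one_lt ?_
  by_contra! hdiv
  obtain ⟨d, hd⟩ := hdiv
  -- the subgroup of `p`-th powers in `D`, seen as a normal subgroup of `G`
  let E : Subgroup G := ((powMonoidHom p : D →* D).range.map D.subtype).map W.subtype
  have hE : ∀ x, x ∈ E ↔ ∃ y ∈ W ⊓ C, y ^ p = x := fun x => by
    constructor
    · rintro ⟨_, ⟨_, ⟨y, rfl⟩, rfl⟩, rfl⟩
      exact ⟨y, ⟨y.1.2, y.2⟩, rfl⟩
    · rintro ⟨y, ⟨hyW, hyC⟩, rfl⟩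
      exact ⟨_, ⟨_, ⟨⟨⟨y, hyW⟩, hyC⟩, rfl⟩, rfl⟩, rfl⟩
  have hEn : E.Normal := ⟨fun x hx g => by
    obtain ⟨y, hy, rfl⟩ := (hE x).1 hx
    exact (hE _).2 ⟨g * y * g⁻¹, Normal.conj_mem inferInstance y hy g, conj_pow⟩⟩
  have hdE : (d : G) ∉ E := fun h => by
    obtain ⟨y, ⟨hyW, hyC⟩, hyd⟩ := (hE _).1 h
    exact hd ⟨⟨y, hyW⟩, hyC⟩ (Subtype.ext (Subtype.ext hyd))
  have hQRF : Group.ResiduallyFinite (G ⧸ E) :=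
    (hG.of_surjective (QuotientGroup.mk'_surjective E)).residuallyFinite
  obtain ⟨K, hK⟩ := Group.exists_finiteIndexNormalSubgroup_notMem (QuotientGroup.mk' E d)
    fun h => hdE ((QuotientGroup.eq_one_iff _).1 h)
  -- the finite quotient `f : G → R` in which `d` has order `p`
  let f : G →* (G ⧸ E) ⧸ K.toSubgroup :=
    (QuotientGroup.mk' K.toSubgroup).comp (QuotientGroup.mk' E)
  have hf : Function.Surjective f :=
    (QuotientGroup.mk'_surjective _).comp (QuotientGroup.mk'_surjective _)
  have hfd : orderOf (f d) = p := by
    have := Fact.mk hp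
    refine orderOf_eq_prime ?_ fun h => hK ((QuotientGroup.eq_one_iff _).1 h)
    have : QuotientGroup.mk' E ((d : G) ^ p) = 1 :=
      (QuotientGroup.eq_one_iff _).2 ((hE _).2 ⟨d, ⟨d.1.2, d.2⟩, rfl⟩)
    rw [← map_pow, MonoidHom.comp_apply, this, map_one]
  have hRfin : Finite ((G ⧸ E) ⧸ K.toSubgroup) := inferInstance
  have hLn : (L.map f).Normal := Normal.map inferInstance f hf
  have hLmapnil : Group.IsNilpotent (L.map f) :=
    Group.nilpotent_of_surjective (f.subgroupMap L) (f.subgroupMap_surjective L)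
  refine not_dvd_card_wordSubgroup hp ((hMw.mono inf_le_left).map hf : IsMarginal w (L.map f))
    (fun h => ?_) (?_ : p ∣ Nat.card (wordSubgroup w ((G ⧸ E) ⧸ K.toSubgroup)))
  · have := Nat.le_of_dvd (Nat.pos_of_ne_zero hLf.index_ne_zero) (h.trans (L.index_map_dvd hf))
    omega
  · rw [← hfd]
    exact Subgroup.orderOf_dvd_natCard _ (map_wordSubgroup_le f (mem_map_of_mem f d.1.2))

/-! ### Reduction to finitely generated groups -/

theorem exists_finset_lift_word_eq (w : FreeGroup ℕ) : ∃ s : Finset ℕ, ∀ (G : Type u) [Group G]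
    (g g' : ℕ → G), (∀ i ∈ s, g i = g' i) → FreeGroup.lift g w = FreeGroup.lift g' w := by
  induction w using FreeGroup.induction_on with
  | C1 => exact ⟨∅, fun G _ g g' _ => by simp⟩
  | of i => exact ⟨{i}, fun G _ g g' h => by simpa using h⟩
  | inv_of i ih =>
    obtain ⟨s, hs⟩ := ih
    exact ⟨s, fun G _ g g' h => by rw [map_inv, map_inv, hs G g g' h]⟩
  | mul x y hx hy =>
    obtain ⟨s, hs⟩ := hx
    obtain ⟨t, ht⟩ := hy
    exact ⟨s ∪ t, fun G _ g g' h => by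
      rw [map_mul, map_mul, hs G g g' fun i hi => h i (Finset.mem_union_left _ hi),
        ht G g g' fun i hi => h i (Finset.mem_union_right _ hi)]⟩

/-- Every word is concise in the class of virtually nilpotent groups: the finitely many arguments
that produce all values of `w` generate a subgroup with the same verbal subgroup. -/
theorem finite_wordSubgroup {w : FreeGroup ℕ} {G : Type u} [Group G]
    (hG : Group.IsVirtuallyNilpotent G) (hw : (wordValues w G).Finite) :
    Finite (wordSubgroup w G) := by
  obtain ⟨s, hs⟩ := exists_finset_lift_word_eq.{u} w
  have hfin : Finite (wordValues w G) := hw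
  choose g hg using fun v : wordValues w G => v.2
  set H := closure (⋃ v, g v '' (s : Set ℕ)) with hH
  have hSfin : Finite ↑(⋃ v, g v '' (s : Set ℕ)) :=
    (Set.finite_iUnion fun v => s.finite_toSet.image (g v)).to_subtype
  have hHfg : Group.FG H := Group.closure_finite_fg _
  have hHw : (wordValues w H).Finite :=
    Set.Finite.of_finite_image (hw.subset (image_wordValues_subset H.subtype))
      H.subtype_injective.injOn
  have hfinH : Finite (wordSubgroup w H) := finite_wordSubgroup_of_fg (hG.subgroup H) hHw
  have hle : wordSubgroup w G ≤ (wordSubgroup w H).map H.subtype := by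
    rw [wordSubgroup, closure_le]
    intro v hv
    classical
    let g' : ℕ → H := fun i => if hi : i ∈ s then
      ⟨g ⟨v, hv⟩ i, subset_closure (Set.mem_iUnion.2 ⟨⟨v, hv⟩, i, hi, rfl⟩)⟩ else 1
    refine ⟨FreeGroup.lift g' w, subset_closure ⟨g', rfl⟩, ?_⟩
    refine (map_lift_word H.subtype w g').trans (Eq.trans ?_ (hg ⟨v, hv⟩))
    refine hs G _ _ fun i hi => ?_
    simp [g', hi]
  have : Finite ((wordSubgroup w H).map H.subtype) :=
    (Set.Finite.image H.subtype (Set.toFinite (wordSubgroup w H : Set H))).to_subtype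
  exact Finite.of_injective _ (inclusion_injective hle)

/-! ### Growth of the powers of a generating set -/

section Growth

open scoped Pointwise

theorem closure_div_self {G : Type*} [Group G] {V : Set G} (h1 : (1 : G) ∈ V) :
    closure (V / V) = closure V := by
  refine le_antisymm ((closure_le _).2 ?_) (closure_mono fun v hv => ⟨v, hv, 1, h1, div_one v⟩)
  rintro _ ⟨a, ha, b, hb, rfl⟩
  exact div_mem (subset_closure ha) (subset_closure hb)

/-- The sets `T ^ n` grow strictly until they exhaust the subgroup generated by `T`. -/
theorem add_one_le_card_pow_of_lt_encard {G : Type*} [Group G] [DecidableEq G] {T : Finset G}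
    (h1 : (1 : G) ∈ T) {r : ℕ} (hr : (r : ℕ∞) < (closure (T : Set G) : Set G).encard) {n : ℕ}
    (hn : n ≤ r) : n + 1 ≤ (T ^ n).card := by
  induction n with
  | zero => simp
  | succ n ih =>
    have ih := ih (by omega)
    by_cases hT : ((T ^ n : Finset G) : Set G) = closure (T : Set G)
    · rw [← hT, Set.encard_coe_eq_coe_finsetCard] at hr
      have hr' : r < (T ^ n).card := by exact_mod_cast hr
      have := Finset.card_le_card (Finset.pow_subset_pow_right h1 (Nat.le_add_right n 1))
      omega
    · have hnt : T.Nontrivial := by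
        by_contra hnt
        obtain rfl : T = {1} :=
          (Finset.eq_singleton_or_nontrivial h1).resolve_right hnt
        simp [closure_singleton_one] at hT
      have := Finset.card_lt_card
        (Finset.pow_ssubset_pow_succ_of_pow_ne_closure h1 hnt (by exact_mod_cast hT) : T ^ n ⊂ _)
      omega

theorem exists_injective_mem_pow_div {G : Type*} [Group G] {V : Set G} (hV : V.Finite)
    (h1 : (1 : G) ∈ V) {r : ℕ} (hr : (r : ℕ∞) < (closure V : Set G).encard) :
    ∃ e : Fin (r + 1) → G, Function.Injective e ∧ ∀ k, e k ∈ (V / V) ^ r := by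
  classical
  have hT : ((hV.div hV).toFinset : Set G) = V / V := (hV.div hV).coe_toFinset
  have hcard : r + 1 ≤ ((hV.div hV).toFinset ^ r).card := by
    refine add_one_le_card_pow_of_lt_encard ?_ ?_ le_rfl
    · rw [Set.Finite.mem_toFinset]
      exact ⟨1, h1, 1, h1, div_one 1⟩
    · rwa [hT, closure_div_self h1]
  refine ⟨fun k => (Finset.equivFin _).symm (Fin.castLE hcard k), fun k l h => ?_, fun k => ?_⟩
  · simpa using h
  · have h : ((hV.div hV).toFinset ^ r : Set G) = (V / V) ^ r := by rw [hT]
    rw [← h, ← Finset.coe_pow]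
    exact Subtype.prop _

end Growth

/-! ### Ultraproducts of groups -/

section Ultraproduct

open scoped Pointwise

variable {ι : Type*} (F : Ultrafilter ι)

/-- A map to `Fin m` on each factor has an ultralimit `L` on the product; families with the same
`L` have the same value under `q i` for almost all `i`. -/
theorem Ultrafilter.exists_forall_eventually_eq {X : ι → Type*} {m : ℕ} (q : ∀ i, X i → Fin m) :
    ∃ L : (∀ i, X i) → Fin m, ∀ x, ∀ᶠ i in F, q i (x i) = L x := by
  have h : ∀ x : ∀ i, X i, ∃ j, ∀ᶠ i in F, q i (x i) = j := fun x =>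
    Ultrafilter.eventually_exists_iff.1 (Filter.Eventually.of_forall fun i => ⟨_, rfl⟩)
  exact ⟨fun x => (h x).choose, fun x => (h x).choose_spec⟩

variable (G : ι → Type u) [∀ i, Group (G i)]

/-- The normal subgroup of the families that are trivial almost everywhere; the quotient by it is
the ultraproduct of the groups `G i`. -/
def ultraKernel : Subgroup (∀ i, G i) where
  carrier := {x | ∀ᶠ i in F, x i = 1}
  one_mem' := Filter.Eventually.of_forall fun _ => rfl
  mul_mem' := fun hx hy => by
    filter_upwards [hx, hy] with i hx hy
    rw [Pi.mul_apply, hx, hy, one_mul]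
  inv_mem' := fun hx => by
    filter_upwards [hx] with i hx
    rw [Pi.inv_apply, hx, inv_one]

instance ultraKernel_normal : (ultraKernel F G).Normal :=
  ⟨fun x hx y => by
    filter_upwards [show ∀ᶠ i in F, x i = 1 from hx] with i hx
    simp [hx]⟩

variable {G}

theorem mk_ultraKernel_eq_iff {x y : ∀ i, G i} :
    QuotientGroup.mk' (ultraKernel F G) x = QuotientGroup.mk' (ultraKernel F G) y ↔
      ∀ᶠ i in F, x i = y i := by
  refine QuotientGroup.eq.trans ?_
  change (∀ᶠ i in F, (x i)⁻¹ * y i = 1) ↔ _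
  simp only [inv_mul_eq_one]

theorem mk_mem_wordValues {w : FreeGroup ℕ} {x : ∀ i, G i} (hx : ∀ i, x i ∈ wordValues w (G i)) :
    QuotientGroup.mk' (ultraKernel F G) x ∈ wordValues w ((∀ i, G i) ⧸ ultraKernel F G) := by
  choose g hg using hx
  have h : FreeGroup.lift (fun j i => g i j) w = x := funext fun i => by
    rw [← hg i]
    exact map_lift_word (Pi.evalMonoidHom G i) w fun j i => g i j
  exact image_wordValues_subset _ ⟨x, ⟨_, h⟩, rfl⟩

theorem exists_mk_of_mem_wordValues {w : FreeGroup ℕ} {v : (∀ i, G i) ⧸ ultraKernel F G}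
    (hv : v ∈ wordValues w ((∀ i, G i) ⧸ ultraKernel F G)) :
    ∃ x : ∀ i, wordValues w (G i), QuotientGroup.mk' (ultraKernel F G) (fun i => (x i).1) = v := by
  obtain ⟨g, rfl⟩ := hv
  choose g' hg' using fun j => QuotientGroup.mk'_surjective (ultraKernel F G) (g j)
  obtain rfl : (fun j => QuotientGroup.mk' (ultraKernel F G) (g' j)) = g := funext hg'
  refine ⟨fun i => ⟨FreeGroup.lift (fun j => g' j i) w, _, rfl⟩, ?_⟩
  refine Eq.trans ?_ (map_lift_word (QuotientGroup.mk' (ultraKernel F G)) w g')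
  congr 1
  exact funext fun i => (map_lift_word (Pi.evalMonoidHom G i) w g').symm

theorem exists_injective_fin {α : Type*} [Finite α] {m : ℕ} (h : Nat.card α ≤ m) :
    ∃ q : α → Fin m, Function.Injective q :=
  ⟨fun a => Fin.castLE h (Finite.equivFin α a),
    (Fin.castLE_injective h).comp (Finite.equivFin α).injective⟩

theorem finite_wordValues_ultraproduct {w : FreeGroup ℕ} {m : ℕ}
    (h : ∀ i, (wordValues w (G i)).encard ≤ (m : ℕ∞)) :
    (wordValues w ((∀ i, G i) ⧸ ultraKernel F G)).Finite := by
  have hq : ∀ i, ∃ q : wordValues w (G i) → Fin m, Function.Injective q := fun i => by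
    obtain ⟨hfin, hle⟩ := Set.encard_le_coe_iff_finite_ncard_le.1 (h i)
    have : Finite (wordValues w (G i)) := hfin
    exact exists_injective_fin hle
  choose q hq using hq
  obtain ⟨L, hL⟩ := F.exists_forall_eventually_eq q
  choose x hx using fun v : wordValues w ((∀ i, G i) ⧸ ultraKernel F G) =>
    exists_mk_of_mem_wordValues F v.2
  have : Finite (wordValues w ((∀ i, G i) ⧸ ultraKernel F G)) := by
    refine Finite.of_injective (fun v => L (x v)) fun v v' hvv' => Subtype.ext ?_
    rw [← hx v, ← hx v', mk_ultraKernel_eq_iff]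
    filter_upwards [hL (x v), hL (x v')] with i h1 h2
    exact congrArg Subtype.val (hq i (h1.trans (hvv'.trans h2.symm)))
  exact this

theorem mk_mem_wordSubgroup {w : FreeGroup ℕ} (r : ℕ) {x : ∀ i, G i}
    (hx : ∀ i, x i ∈ (wordValues w (G i) / wordValues w (G i)) ^ r) :
    QuotientGroup.mk' (ultraKernel F G) x ∈ wordSubgroup w ((∀ i, G i) ⧸ ultraKernel F G) := by
  induction r generalizing x with
  | zero =>
    obtain rfl : x = 1 := funext fun i => by simpa using hx i
    rw [map_one]
    exact one_mem _
  | succ r ih =>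
    simp only [pow_succ, Set.mem_mul, Set.mem_div] at hx
    choose y hy z hz hyz using hx
    choose a ha b hb hab using hz
    obtain rfl : y * (a / b) = x := funext fun i => by
      rw [Pi.mul_apply, Pi.div_apply, hab, hyz]
    rw [map_mul, map_div]
    exact mul_mem (ih hy) (div_mem (subset_closure (mk_mem_wordValues F ha))
      (subset_closure (mk_mem_wordValues F hb)))

theorem isVirtuallyNilpotent_ultraproduct {c t : ℕ} (h : ∀ i, NilpotentByBoundedIndex c t (G i)) :
    Group.IsVirtuallyNilpotent ((∀ i, G i) ⧸ ultraKernel F G) := by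
  choose N hNn hNf hNt hNnil hNc using h
  let φ : (∀ i, N i) →* (∀ i, G i) ⧸ ultraKernel F G :=
    (QuotientGroup.mk' (ultraKernel F G)).comp
      (MonoidHom.pi fun i => (N i).subtype.comp (Pi.evalMonoidHom (fun i => N i) i))
  have hnil : Group.IsNilpotent (∀ i, N i) := Group.isNilpotent_pi_of_bounded_class c hNc
  refine ⟨φ.range, Group.nilpotent_of_surjective φ.rangeRestrict φ.rangeRestrict_surjective, ?_⟩
  have hq : ∀ i, ∃ q : G i ⧸ N i → Fin t, Function.Injective q := fun i =>
    exists_injective_fin (hNt i)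
  choose q hq using hq
  obtain ⟨L, hL⟩ := F.exists_forall_eventually_eq fun i (x : G i) => q i (x : G i ⧸ N i)
  choose x hx using fun a : ((∀ i, G i) ⧸ ultraKernel F G) ⧸ φ.range =>
    QuotientGroup.mk'_surjective (ultraKernel F G) a.out
  have : Finite (((∀ i, G i) ⧸ ultraKernel F G) ⧸ φ.range) := by
    refine Finite.of_injective (fun a => L (x a)) fun a b hab => ?_
    rw [← QuotientGroup.out_eq' a, ← QuotientGroup.out_eq' b, QuotientGroup.eq, ← hx a, ← hx b,
      ← map_inv, ← map_mul]
    classical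
    refine ⟨fun i => if hi : (x a i)⁻¹ * x b i ∈ N i then ⟨_, hi⟩ else 1, ?_⟩
    refine (mk_ultraKernel_eq_iff F).2 ?_
    filter_upwards [hL (x a), hL (x b)] with i h1 h2
    have hi : (x a i)⁻¹ * x b i ∈ N i :=
      QuotientGroup.eq.1 (hq i (h1.trans (hab.trans h2.symm)))
    simp [MonoidHom.pi, hi]
  exact finiteIndex_of_finite_quotient

/-- If almost every `w(G i)` has more than `r` elements, so has `w` of the ultraproduct. The point
is that the `r + 1` elements can be chosen as products of `r` factors `a * b⁻¹` with `a`, `b` values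
of `w`; for products of unbounded length the class of the family need not lie in the verbal
subgroup of the ultraproduct. -/
theorem lt_card_wordSubgroup_ultraproduct {w : FreeGroup ℕ} {r : ℕ}
    (hV : ∀ i, (wordValues w (G i)).Finite)
    (hr : ∀ᶠ i in F, (r : ℕ∞) < (wordSubgroup w (G i) : Set (G i)).encard)
    [Finite (wordSubgroup w ((∀ i, G i) ⧸ ultraKernel F G))] :
    r < Nat.card (wordSubgroup w ((∀ i, G i) ⧸ ultraKernel F G)) := by
  have h1 : ∀ i, (1 : G i) ∈ wordValues w (G i) := fun i =>
    ⟨1, (map_lift_word (1 : G i →* G i) w 1).symm⟩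
  have he : ∀ i, ∃ e : Fin (r + 1) → G i,
      ((r : ℕ∞) < (wordSubgroup w (G i) : Set (G i)).encard → Function.Injective e) ∧
      ∀ k, e k ∈ (wordValues w (G i) / wordValues w (G i)) ^ r := fun i => by
    by_cases hi : (r : ℕ∞) < (wordSubgroup w (G i) : Set (G i)).encard
    · obtain ⟨e, he, hmem⟩ := exists_injective_mem_pow_div (hV i) (h1 i) hi
      exact ⟨e, fun _ => he, hmem⟩
    · exact ⟨1, fun h => absurd h hi, fun _ =>
        Set.one_mem_pow ⟨1, h1 i, 1, h1 i, div_one 1⟩⟩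
  choose e hinj hmem using he
  let E : Fin (r + 1) → wordSubgroup w ((∀ i, G i) ⧸ ultraKernel F G) := fun k =>
    ⟨QuotientGroup.mk' (ultraKernel F G) fun i => e i k, mk_mem_wordSubgroup F r fun i => hmem i k⟩
  have hE : Function.Injective E := fun k l hkl => by
    have h2 := (mk_ultraKernel_eq_iff F).1 (congrArg Subtype.val hkl)
    obtain ⟨i, h2, h3⟩ := (h2.and hr).exists
    exact hinj i h3 h2
  have := Nat.card_le_card_of_injective E hE
  rwa [Nat.card_fin] at this

end Ultraproduct

/-! ### Bounded conciseness -/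

theorem proposition6p1 (c t : ℕ) (hc : 0 < c) (ht : 0 < t) (w : FreeGroup ℕ) :
    BoundedlyConciseIn.{u} w (fun G [Group G] => NilpotentByBoundedIndex c t G) := by
  intro m
  by_contra! hcon
  -- a counterexample `G ν` for each bound `ν`; their ultraproduct contradicts `finite_wordSubgroup`
  choose G inst hX hV hW using hcon
  let F : Ultrafilter ℕ := Filter.hyperfilter ℕ
  have hfin : Finite (wordSubgroup w ((∀ i, G i) ⧸ ultraKernel F G)) :=
    finite_wordSubgroup (isVirtuallyNilpotent_ultraproduct F hX)
      (finite_wordValues_ultraproduct F hV)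
  refine (lt_card_wordSubgroup_ultraproduct F
    (fun i => Set.finite_of_encard_le_coe (hV i)) ?_).false
  have hle : ∀ᶠ i in F,
      Nat.card (wordSubgroup w ((∀ i, G i) ⧸ ultraKernel F G)) ≤ i :=
    Nat.hyperfilter_le_atTop (Filter.eventually_ge_atTop _)
  filter_upwards [hle] with i hi
  exact lt_of_le_of_lt (by exact_mod_cast hi) (hW i)
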